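/- Let $k$ be a natural number, ${\bf n}=(n_1,\dots,n_k)$ and ${\bf m}=(m_1,\dots,m_k)$ with $n_i,m_i\ge 1$, and let $\mathcal K$ be a complex Hilbert space. For each $i$ let $\mathbb F_{n_i}^+$ be the free monoid of words in $n_i$ letters $g^i_1,\dots,g^i_{n_i}$, with word length $|\cdot|$, and let $F^2(H_{n_i})$ be the full Fock space with orthonormal basis $\{e^i_\alpha\}_{\alpha\in\mathbb F_{n_i}^+}$. Let $W_{i,j}$ be the weighted left creation operator $W_{i,j}e^i_\alpha=\sqrt{\tfrac{|\alpha|+1}{|\alpha|+m_i}}\;e^i_{g_j\alpha}$, let ${\bf W}_{i,j}=I\otimes\cdots\otimes W_{i,j}\otimes\cdots\otimes I$ act on $\bigotimes_{s=1}^kF^2(H_{n_s})$ (with $W_{i,j}$ in the $i$-th position), and let ${\bf W}=({\bf W}_{i,j})$. For a complex Hilbert space $\mathcal H$ and operators $X_{i,j}\in B(\mathcal H)$ ($1\le i\le k$, $1\le j\le n_i$) put $\Phi_{X_i}(Y)=\sum_{j}X_{i,j}YX_{i,j}^*$, and $X_{i,\alpha}=X_{i,j_1}\cdots X_{i,j_p}$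 for $\alpha=g^i_{j_1}\cdots g^i_{j_p}$. The poly-hyperball ${\bf D_n^m}(\mathcal H)$ is the set of all ${\bf X}=(X_{i,j})$ such that the entries of $X_p$ commute with those of $X_q$ for $p\neq q$ and $(id-\Phi_{X_1})^{p_1}\circ\cdots\circ(id-\Phi_{X_k})^{p_k}(I)\ge 0$ whenever $0\le p_i\le m_i$ for all $i$; its radial part is ${\bf D}^{\bf m}_{{\bf n},rad}(\mathcal H)=\bigcup_{0\le r<1}r\,{\bf D_n^m}(\mathcal H)$. A free $k$-pluriharmonic function $F$ on the radial part with coefficients $A_{(\boldsymbol\alpha,\boldsymbol\beta)}\in B(\mathcal K)$ is a series $$F({\bf X})=\sum_{s_1\in\mathbb Z}\cdots\sum_{s_k\in\mathbb Z}q_{s_1,\dots,s_k}({\bf X},{\bf X}^*),\qquad q_{s_1,\dots,s_k}({\bf X},{\bf X}^*)=\sum_{\substack{\alpha_i,\beta_i\in\mathbb F_{n_i}^+\\|\alpha_i|=s_i^+,\ |\beta_i|=s_i^-}}A_{(\boldsymbol\alpha,\boldsymbol\beta)}\otimes X_{1,\alpha_1}\cdots X_{k,\alpha_k}X_{1,\beta_1}^*\cdots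 X_{k,\beta_k}^*,$$ which converges in the operator norm for every Hilbert space $\mathcal H$ and every ${\bf X}\in{\bf D}^{\bf m}_{{\bf n},rad}(\mathcal H)$; here $s^+=\max\{s,0\}$, $s^-=\max\{-s,0\}$, and each sum over $\mathbb Z$ is the limit of its symmetric partial sums. It is bounded if $\sup\|F({\bf X})\|<\infty$, the supremum being over all such ${\bf X}$ and $\mathcal H$. Let $\mathcal P_{\mathcal K}$ be the linear span of the vectors $h\otimes e^1_{\alpha_1}\otimes\cdots\otimes e^k_{\alpha_k}$ with $h\in\mathcal K$, $\alpha_i\in\mathbb F_{n_i}^+$. **Statement.** Let $T\in B(\mathcal K\otimes\bigotimes_{s=1}^kF^2(H_{n_s}))$ and let $F$ be a bounded free $k$-pluriharmonic function on the radial part of ${\bf D_n^m}$ with coefficients in $B(\mathcal K)$ such that $T=\text{SOT-}\lim_{r\to1^-}F(r{\bf W})$. Then $r{\bf W}\in{\bf D}^{\bf m}_{{\bf n},rad}(\bigotimes_{s=1}^kF^2(H_{n_s}))$ for every $r\in[0,1)$, the function $r\mapsto\|F(r{\bf W})\|$ is increasing on $[0,1)$, for every $p\in\mathcal P_{\mathcal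 K}$ the series $F({\bf W})p:=\sum_{s_1\in\mathbb Z}\cdots\sum_{s_k\in\mathbb Z}q_{s_1,\dots,s_k}({\bf W},{\bf W}^*)p$ converges in norm, and $$\|T\|=\sup_{r\in[0,1)}\|F(r{\bf W})\|=\lim_{r\to1^-}\|F(r{\bf W})\|=\sup_{p\in\mathcal P_{\mathcal K},\ \|p\|\le1}\|F({\bf W})p\|.$$ -/

import Mathlib

open Filter Topology
open scoped TensorProduct

noncomputable section

namespace PolyHyperball

/-! ### Hilbert tensor products -/

/-- The Hilbert space tensor product `K ⊗ H`: the completion of the algebraic tensor product for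
the inner product `⟪x ⊗ y, x' ⊗ y'⟫ = ⟪x, x'⟫ ⟪y, y'⟫`. -/
abbrev HTensor (K H : Type*) [NormedAddCommGroup K] [InnerProductSpace ℂ K]
    [NormedAddCommGroup H] [InnerProductSpace ℂ H] : Type _ :=
  UniformSpace.Completion (K ⊗[ℂ] H)

section Tensor

variable {K H : Type*} [NormedAddCommGroup K] [InnerProductSpace ℂ K]
  [NormedAddCommGroup H] [InnerProductSpace ℂ H]

/-- The elementary tensor `x ⊗ y` in the Hilbert tensor product. -/
def htmul (x : K) (y : H) : HTensor K H :=
  ((x ⊗ₜ[ℂ] y : K ⊗[ℂ] H) : UniformSpace.Completion (K ⊗[ℂ] H))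

/-- The bounded operator `A ⊗ B` on `K ⊗ H`, with `(A ⊗ B) (x ⊗ y) = A x ⊗ B y`. -/
def opTensor (A : K →L[ℂ] K) (B : H →L[ℂ] H) : HTensor K H →L[ℂ] HTensor K H :=
  (TensorProduct.mapL A B).completion

end Tensor

/-! ### Words and tuples of operators -/

/-- `k`-tuples `(α₁, …, α_k)` with `α_i` a word in `n_i` letters; words are lists of letters. -/
abbrev MultiWord {k : ℕ} (n : Fin k → ℕ) : Type := ∀ i : Fin k, List (Fin (n i))

/-- Tuples `X = (X₁, …, X_k)`, `X_i = (X_{i,1}, …, X_{i,n_i})`, of bounded operators on `H`. -/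
abbrev OpTuple {k : ℕ} (n : Fin k → ℕ) (H : Type*) [NormedAddCommGroup H]
    [InnerProductSpace ℂ H] : Type _ :=
  ∀ i : Fin k, Fin (n i) → (H →L[ℂ] H)

section Tuples

variable {k : ℕ} {n : Fin k → ℕ} {H : Type*} [NormedAddCommGroup H] [InnerProductSpace ℂ H]

/-- `X_{i,α} = X_{i,j₁} ⋯ X_{i,j_p}` for the word `α = g_{j₁} ⋯ g_{j_p}` (the identity for the
empty word). -/
def wordOp (X : OpTuple n H) (i : Fin k) (α : List (Fin (n i))) : H →L[ℂ] H :=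
  (α.map (X i)).prod

variable [CompleteSpace H]

/-- `X_{1,α₁} ⋯ X_{k,α_k} X_{1,β₁}^* ⋯ X_{k,β_k}^*`. -/
def monomial (X : OpTuple n H) (α β : MultiWord n) : H →L[ℂ] H :=
  (List.ofFn fun i : Fin k => wordOp X i (α i)).prod *
    (List.ofFn fun i : Fin k => star (wordOp X i (β i))).prod

/-- The linear map `Φ_{X_i} : Y ↦ ∑_j X_{i,j} Y X_{i,j}^*` on `B(H)`. -/
def phi (X : OpTuple n H) (i : Fin k) : Module.End ℂ (H →L[ℂ] H) :=
  ∑ j : Fin (n i), LinearMap.mulLeft ℂ (X i j) ∘ₗ LinearMap.mulRight ℂ (star (X i j))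

/-- `Δ_X^p = (id - Φ_{X₁})^{p₁} ∘ ⋯ ∘ (id - Φ_{X_k})^{p_k}`. -/
def defect (X : OpTuple n H) (p : Fin k → ℕ) : Module.End ℂ (H →L[ℂ] H) :=
  (List.ofFn fun i : Fin k => (1 - phi X i) ^ p i).prod

/-- The noncommutative poly-hyperball `D_n^m(H)`: for `p ≠ q` the entries of `X_p` commute with
those of `X_q`, and `Δ_X^p(I) ≥ 0` for all `0 ≤ p ≤ m`. -/
def ball (n m : Fin k → ℕ) (H : Type*) [NormedAddCommGroup H] [InnerProductSpace ℂ H]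
    [CompleteSpace H] : Set (OpTuple n H) :=
  {X | (∀ p q : Fin k, p ≠ q → ∀ (a : Fin (n p)) (b : Fin (n q)), Commute (X p a) (X q b)) ∧
    ∀ p : Fin k → ℕ, p ≤ m → (defect X p 1).IsPositive}

/-- The tuple `r X`. -/
def scale (r : ℝ) (X : OpTuple n H) : OpTuple n H := fun i j => (r : ℂ) • X i j

/-- The radial poly-hyperball `⋃_{0 ≤ r < 1} r D_n^m(H)`. -/
def radialBall (n m : Fin k → ℕ) (H : Type*) [NormedAddCommGroup H] [InnerProductSpace ℂ H]
    [CompleteSpace H] : Set (OpTuple n H) :=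
  {Y | ∃ r ∈ Set.Ico (0 : ℝ) 1, ∃ X ∈ ball n m H, Y = scale r X}

end Tuples

/-! ### Nested series `∑_{s₁ ∈ ℤ} ⋯ ∑_{s_k ∈ ℤ}` -/

/-- The nested series `∑_{s₁ ∈ ℤ} ⋯ ∑_{s_k ∈ ℤ} f(s₁, …, s_k)` converges to `a`: each single series
`∑_{s ∈ ℤ}` is the limit of `∑_{|s| ≤ N}` as `N → ∞`. -/
def HasNestedSum {E : Type*} [AddCommMonoid E] [TopologicalSpace E] :
    (k : ℕ) → ((Fin k → ℤ) → E) → E → Prop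
  | 0, f, a => f Fin.elim0 = a
  | k + 1, f, a => ∃ g : ℤ → E, (∀ s : ℤ, HasNestedSum k (fun t => f (Fin.cons s t)) (g s)) ∧
      Tendsto (fun N : ℕ => ∑ s ∈ Finset.Icc (-(N : ℤ)) N, g s) atTop (𝓝 a)

open Classical in
/-- The value of a nested series (`0` if it does not converge). -/
def nestedSum {E : Type*} [AddCommMonoid E] [TopologicalSpace E] {k : ℕ}
    (f : (Fin k → ℤ) → E) : E :=
  if h : ∃ a, HasNestedSum k f a then h.choose else 0

/-! ### Free `k`-pluriharmonic functions -/

/-- Families `A_{(α, β)}` of coefficients in `B(K)`. Only the pairs `(α, β)` for which there is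
`s ∈ ℤ^k` with `|α_i| = s_i^+`, `|β_i| = s_i^-` for all `i` are ever used. -/
abbrev Coeffs {k : ℕ} (n : Fin k → ℕ) (K : Type*) [NormedAddCommGroup K]
    [InnerProductSpace ℂ K] : Type _ :=
  MultiWord n → MultiWord n → (K →L[ℂ] K)

section Pluriharmonic

variable {k : ℕ} {n : Fin k → ℕ} {K H : Type*} [NormedAddCommGroup K] [InnerProductSpace ℂ K]
  [NormedAddCommGroup H] [InnerProductSpace ℂ H] [CompleteSpace H]

/-- The multi-homogeneous polynomial
`q_s(X, X^*) = ∑_{|α_i| = s_i^+, |β_i| = s_i^-} A_{(α, β)} ⊗ X_{1,α₁} ⋯ X_{k,α_k} X_{1,β₁}^* ⋯ X_{k,β_k}^*`;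
words of length `l` in `N` letters are enumerated as functions `Fin l → Fin N`. -/
def homPart (A : Coeffs n K) (X : OpTuple n H) (s : Fin k → ℤ) :
    HTensor K H →L[ℂ] HTensor K H :=
  ∑ a : (∀ i, Fin (s i).toNat → Fin (n i)), ∑ b : (∀ i, Fin (-s i).toNat → Fin (n i)),
    opTensor (A (fun i => List.ofFn (a i)) (fun i => List.ofFn (b i)))
      (monomial X (fun i => List.ofFn (a i)) (fun i => List.ofFn (b i)))

/-- The value `F(X) = ∑_{s₁} ⋯ ∑_{s_k} q_s(X, X^*)`, a nested series in the operator norm. -/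
def evalOp (A : Coeffs n K) (X : OpTuple n H) : HTensor K H →L[ℂ] HTensor K H :=
  nestedSum fun s => homPart A X s

/-- The value `F(X) x = ∑_{s₁} ⋯ ∑_{s_k} q_s(X, X^*) x` at a vector, a nested series in the norm
of `K ⊗ H`. -/
def evalVec (A : Coeffs n K) (X : OpTuple n H) (x : HTensor K H) : HTensor K H :=
  nestedSum fun s => homPart A X s x

end Pluriharmonic

universe u v

/-- The coefficients `A` define a free `k`-pluriharmonic function `F` on the radial poly-hyperball:
for every Hilbert space `H` and every `X` in the radial poly-hyperball over `H` the series `F(X)`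
converges in the operator norm. -/
def IsFreePluriharmonic {k : ℕ} {n : Fin k → ℕ} (m : Fin k → ℕ) {K : Type u}
    [NormedAddCommGroup K] [InnerProductSpace ℂ K] (A : Coeffs n K) : Prop :=
  ∀ (H : Type v) [NormedAddCommGroup H] [InnerProductSpace ℂ H] [CompleteSpace H],
    ∀ X ∈ radialBall n m H,
      ∃ Y : HTensor K H →L[ℂ] HTensor K H, HasNestedSum k (fun s => homPart A X s) Y

/-- The free `k`-pluriharmonic function with coefficients `A` is bounded:
`‖F(X)‖` is bounded uniformly over all `X` and all Hilbert spaces. -/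
def IsBoundedFreePluriharmonic {k : ℕ} {n : Fin k → ℕ} (m : Fin k → ℕ) {K : Type u}
    [NormedAddCommGroup K] [InnerProductSpace ℂ K] (A : Coeffs n K) : Prop :=
  IsFreePluriharmonic.{u, v} m A ∧
    ∃ C : ℝ, ∀ (H : Type v) [NormedAddCommGroup H] [InnerProductSpace ℂ H] [CompleteSpace H],
      ∀ X ∈ radialBall n m H, ‖evalOp A X‖ ≤ C

/-! ### Fock spaces and the universal model -/

section Model

variable {k : ℕ} (n m : Fin k → ℕ)

/-- The tensor product `F²(H_{n₁}) ⊗ ⋯ ⊗ F²(H_{n_k})` of full Fock spaces, realized as `ℓ²` over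
the orthonormal basis `e_α = e_{α₁} ⊗ ⋯ ⊗ e_{α_k}` indexed by tuples of words. -/
abbrev PolyFock : Type := lp (fun _ : MultiWord n => ℂ) 2

variable {n}

/-- The basis vector `e_α`. -/
def basisVec (α : MultiWord n) : PolyFock n := lp.single 2 α 1

/-- The tuple `(α₁, …, g_j α_i, …, α_k)`. -/
def consWord (i : Fin k) (j : Fin (n i)) (α : MultiWord n) : MultiWord n :=
  Function.update α i (j :: α i)

theorem consWord_injective (i : Fin k) (j : Fin (n i)) :
    Function.Injective (consWord (n := n) i j) := by
  intro α β h
  funext l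
  have hl := congrFun h l
  by_cases hli : l = i
  · subst hli
    simpa [consWord] using hl
  · simpa [consWord, hli] using hl

theorem orthonormal_consWord (i : Fin k) (j : Fin (n i)) :
    Orthonormal ℂ fun α : MultiWord n => basisVec (consWord i j α) := by
  have h : Orthonormal ℂ fun α : MultiWord n => basisVec α := by
    rw [orthonormal_iff_ite]
    intro α β
    simp [basisVec, lp.inner_single_left, lp.single_apply, Pi.single_apply]
  exact h.comp _ (consWord_injective i j)

/-- The left creation operator `S_{i,j}` acting on the `i`-th tensor factor:
`e_α ↦ e_{(α₁, …, g_j α_i, …, α_k)}`. -/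
def leftCreation (i : Fin k) (j : Fin (n i)) : PolyFock n →L[ℂ] PolyFock n :=
  (orthonormal_consWord i j).orthogonalFamily.linearIsometry.toContinuousLinearMap

/-- The weight `√((|α_i| + 1) / (|α_i| + m_i))`. -/
def weight (i : Fin k) (α : MultiWord n) : ℝ :=
  Real.sqrt (((α i).length + 1) / ((α i).length + m i))

theorem weight_norm_le (i : Fin k) (α : MultiWord n) :
    ‖((weight m i α : ℝ) : ℂ) • ContinuousLinearMap.id ℂ ℂ‖ ≤ 2 := by
  have h : weight m i α ≤ 2 := by
    unfold weight
    rw [Real.sqrt_le_left (by norm_num)]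
    rcases Nat.eq_zero_or_pos ((α i).length + m i) with h0 | h0
    · have : ((α i).length : ℝ) + m i = 0 := by exact_mod_cast h0
      rw [this]; norm_num
    · have h1 : (1 : ℝ) ≤ ((α i).length : ℝ) + m i := by exact_mod_cast h0
      rw [div_le_iff₀ (by linarith)]
      have := Nat.cast_nonneg (α := ℝ) (m i)
      nlinarith
  have h0 : 0 ≤ weight m i α := Real.sqrt_nonneg _
  rw [norm_smul]
  simpa [abs_of_nonneg h0] using h

/-- The diagonal operator `D_{i,j}` acting on the `i`-th tensor factor:
`e_α ↦ √((|α_i| + 1) / (|α_i| + m_i)) e_α`. -/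
def diagOp (i : Fin k) : PolyFock n →L[ℂ] PolyFock n :=
  lp.mapCLM 2 (fun α : MultiWord n => ((weight m i α : ℝ) : ℂ) • ContinuousLinearMap.id ℂ ℂ)
    (by norm_num) (weight_norm_le m i)

/-- The left universal model `W = (W_{i,j})`, `W_{i,j} = S_{i,j} D_{i,j}` on the `i`-th factor. -/
def universalModel : OpTuple n (PolyFock n) := fun i j => leftCreation i j * diagOp m i

/-- The space `P_K` of polynomial vectors: the linear span of the vectors `h ⊗ e_α`. -/
def polyVectors (n : Fin k → ℕ) (K : Type*) [NormedAddCommGroup K] [InnerProductSpace ℂ K] :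
    Submodule ℂ (HTensor K (PolyFock n)) :=
  Submodule.span ℂ {x | ∃ (h : K) (α : MultiWord n), x = htmul h (basisVec α)}

end Model

end PolyHyperball

end

noncomputable section

namespace PolyHyperball

/-! ### Coordinates in the Fock space -/

section Fock

variable {k : ℕ} {n : Fin k → ℕ}

/-! The Fock space is graded by the multidegree `wordDeg`, and each monomial of `q_s(W, W^*)` shifts
degrees by `s` (`shiftsDeg_monomial`). The matrix entry of `F(rW)` between `h ⊗ e_α` and `h' ⊗ e_β`
therefore comes from the single term `s = wordDeg β - wordDeg α`, and it is `r ^ ∑ |s_i|` times the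
corresponding entry of the formal series `F(W)` (`inner_of_hasNestedSum`). Letting `r → 1`, the
strong limit `T` has exactly the entries of `F(W)`.

Hence `F(rW)` is the Schur product of `T` with the kernel `r ^ ∑ ||β_i| - |α_i||`, and for `0 < s`
likewise `F(rW)` is the Schur product of `F(sW)` with the kernel of parameter `r / s`. For `t ∈ [0,
1]` the kernel `t ^ |a - b|` is a Gram kernel of unit vectors, with explicit factor `cholesky`, so
Schur multiplication by it is contractive (`norm_le_of_schur`). This gives `‖F(rW)‖ ≤ ‖T‖` and
monotonicity in `r`. Conversely, any uniform bound on `‖F(rW)‖` passes to the strong limit, so `‖T‖`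
is the supremum, and by monotonicity the limit.

For `p = h ⊗ e_α` the vectors `q_s(W, W^*) p` are the orthogonal homogeneous components of `T p`.
Bessel's inequality makes the series unconditionally summable, with sum `T p` (`hasSum_homPart`),
and unconditional summability gives the nested convergence. Density of the polynomial vectors then
yields the last formula for `‖T‖`.

That `W` lies in the poly-hyperball is a separate computation (`universalModel_mem_ball`): all
defect operators are diagonal in the basis `e_α`, with entries products of nonnegative ratios of
binomial coefficients. -/

theorem basisVec_apply (α β : MultiWord n) :
    (basisVec α : PolyFock n) β = if β = α then 1 else 0 := by
  simp [basisVec, lp.single_apply, Pi.single_apply]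

theorem inner_basisVec (α : MultiWord n) (x : PolyFock n) : inner ℂ (basisVec α) x = x α := by
  simp [basisVec, lp.inner_single_left]

theorem inner_basisVec_basisVec (α β : MultiWord n) :
    inner ℂ (basisVec α) (basisVec β) = if α = β then (1 : ℂ) else 0 := by
  rw [inner_basisVec, basisVec_apply]

theorem hasSum_basisVec (x : PolyFock n) : HasSum (fun α => x α • basisVec α) x := by
  convert lp.hasSum_single (p := 2) (by norm_num) x using 2 with α
  rw [basisVec, ← lp.single_smul]
  simp

theorem ext_basisVec {E : Type*} [NormedAddCommGroup E] [NormedSpace ℂ E]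
    {A B : PolyFock n →L[ℂ] E} (h : ∀ α, A (basisVec α) = B (basisVec α)) : A = B := by
  ext x
  have hA := (hasSum_basisVec x).mapL A
  have hB := (hasSum_basisVec x).mapL B
  simp only [map_smul, h] at hA hB
  exact hA.unique hB

theorem consWord_same (i : Fin k) (j : Fin (n i)) (α : MultiWord n) :
    consWord i j α i = j :: α i := by
  simp [consWord]

theorem consWord_of_ne {i l : Fin k} (h : l ≠ i) (j : Fin (n i)) (α : MultiWord n) :
    consWord i j α l = α l := by
  simp [consWord, h]

theorem leftCreation_basisVec (i : Fin k) (j : Fin (n i)) (α : MultiWord n) :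
    leftCreation i j (basisVec α) = basisVec (consWord i j α) := by
  simp [leftCreation, basisVec]

variable (m : Fin k → ℕ)

theorem diagOp_apply (i : Fin k) (x : PolyFock n) (α : MultiWord n) :
    diagOp m i x α = (weight m i α : ℂ) * x α := by
  rfl

theorem diagOp_basisVec (i : Fin k) (α : MultiWord n) :
    diagOp m i (basisVec α) = (weight m i α : ℂ) • basisVec α := by
  ext β
  rw [diagOp_apply, lp.coeFn_smul, Pi.smul_apply, smul_eq_mul, basisVec_apply]
  split_ifs with h <;> simp [h]

theorem universalModel_basisVec (i : Fin k) (j : Fin (n i)) (α : MultiWord n) :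
    universalModel m i j (basisVec α) = (weight m i α : ℂ) • basisVec (consWord i j α) := by
  rw [universalModel, mul_apply_eq_comp, diagOp_basisVec, map_smul,
    leftCreation_basisVec]

theorem star_universalModel_apply (i : Fin k) (j : Fin (n i)) (x : PolyFock n)
    (β : MultiWord n) :
    (star (universalModel m i j) x) β = (weight m i β : ℂ) * x (consWord i j β) := by
  rw [← inner_basisVec, ContinuousLinearMap.star_eq_adjoint,
    ContinuousLinearMap.adjoint_inner_right, universalModel_basisVec, inner_smul_left,
    inner_basisVec]
  simp

/-! ### The grading of the Fock space by the lengths of the words -/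

/-- The multidegree `(|α₁|, …, |α_k|)`. -/
def wordDeg (α : MultiWord n) : Fin k → ℤ := fun i => (α i).length

theorem wordDeg_consWord (i : Fin k) (j : Fin (n i)) (α : MultiWord n) :
    wordDeg (consWord i j α) = wordDeg α + Pi.single i 1 := by
  funext l
  by_cases h : l = i
  · subst h
    simp [wordDeg, consWord_same]
  · simp [wordDeg, consWord_of_ne h, h]

/-- The vector `x` is homogeneous of degree `d`. -/
def IsHomogeneous (d : Fin k → ℤ) (x : PolyFock n) : Prop := ∀ β, wordDeg β ≠ d → x β = 0

theorem isHomogeneous_basisVec (α : MultiWord n) : IsHomogeneous (wordDeg α) (basisVec α) := by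
  intro β h
  rw [basisVec_apply, if_neg]
  rintro rfl
  exact h rfl

theorem IsHomogeneous.inner_eq_zero {d e : Fin k → ℤ} {x y : PolyFock n}
    (hx : IsHomogeneous d x) (hy : IsHomogeneous e y) (h : d ≠ e) : inner ℂ x y = 0 := by
  rw [lp.inner_eq_tsum]
  convert tsum_zero with α
  by_cases hd : wordDeg α = d
  · simp [hy α (hd.trans_ne h)]
  · simp [hx α hd]

/-- The operator `A` shifts degrees by `s`. -/
def ShiftsDeg (s : Fin k → ℤ) (A : PolyFock n →L[ℂ] PolyFock n) : Prop :=
  ∀ d x, IsHomogeneous d x → IsHomogeneous (d + s) (A x)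

theorem ShiftsDeg.one : ShiftsDeg 0 (1 : PolyFock n →L[ℂ] PolyFock n) := by
  intro d x hx
  simpa using hx

theorem ShiftsDeg.mul {s t : Fin k → ℤ} {A B : PolyFock n →L[ℂ] PolyFock n}
    (hA : ShiftsDeg s A) (hB : ShiftsDeg t B) : ShiftsDeg (s + t) (A * B) := by
  intro d x hx
  have h := hA _ _ (hB _ _ hx)
  rwa [add_assoc, add_comm t s] at h

theorem ShiftsDeg.star {s : Fin k → ℤ} {A : PolyFock n →L[ℂ] PolyFock n}
    (hA : ShiftsDeg s A) : ShiftsDeg (-s) (star A) := by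
  intro d x hx β hβ
  rw [← inner_basisVec, ContinuousLinearMap.star_eq_adjoint,
    ContinuousLinearMap.adjoint_inner_right]
  refine (hA _ _ (isHomogeneous_basisVec β)).inner_eq_zero hx fun h => hβ ?_
  rw [← h, add_neg_cancel_right]

theorem ShiftsDeg.listProd {ι : Type*} (l : List ι) (s : ι → Fin k → ℤ)
    (A : ι → PolyFock n →L[ℂ] PolyFock n) (h : ∀ i, ShiftsDeg (s i) (A i)) :
    ShiftsDeg (l.map s).sum (l.map A).prod := by
  induction l with
  | nil => simpa using ShiftsDeg.one
  | cons a l ih => simpa using (h a).mul ih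

/-- The adjoint is the easier side: each coordinate of `W_{i,j}^* x` is a multiple of one coordinate
of `x`. Taking adjoints again gives the claim. -/
theorem shiftsDeg_universalModel (i : Fin k) (j : Fin (n i)) :
    ShiftsDeg (Pi.single i 1) (universalModel m i j) := by
  have h : ShiftsDeg (-Pi.single i 1) (star (universalModel m i j)) := by
    intro d x hx β hβ
    rw [star_universalModel_apply, hx, mul_zero]
    rw [wordDeg_consWord]
    intro h
    exact hβ (by rw [← h, add_neg_cancel_right])
  simpa using h.star

theorem shiftsDeg_wordOp (i : Fin k) (α : List (Fin (n i))) :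
    ShiftsDeg (Pi.single i (α.length : ℤ)) (wordOp (universalModel m) i α) := by
  have h := ShiftsDeg.listProd α (fun _ => (Pi.single i 1 : Fin k → ℤ)) (universalModel m i)
    (shiftsDeg_universalModel m i)
  refine cast (congrArg (ShiftsDeg · _) ?_) h
  rw [List.map_const', List.sum_replicate, ← Pi.single_smul]
  simp

theorem sum_ofFn_single (f : Fin k → ℤ) :
    (List.ofFn fun i => (Pi.single i (f i) : Fin k → ℤ)).sum = f := by
  rw [List.sum_ofFn, Finset.univ_sum_single]

theorem shiftsDeg_monomial (α β : MultiWord n) :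
    ShiftsDeg (wordDeg α - wordDeg β) (monomial (universalModel m) α β) := by
  have h1 := ShiftsDeg.listProd (List.finRange k)
    (fun i => (Pi.single i (wordDeg α i) : Fin k → ℤ))
    (fun i => wordOp (universalModel m) i (α i)) (fun i => shiftsDeg_wordOp m i (α i))
  have h2 := ShiftsDeg.listProd (List.finRange k)
    (fun i => (Pi.single i (-wordDeg β i) : Fin k → ℤ))
    (fun i => star (wordOp (universalModel m) i (β i))) (fun i => by
      rw [Pi.single_neg]
      exact (shiftsDeg_wordOp m i (β i)).star)
  rw [← List.ofFn_eq_map, ← List.ofFn_eq_map, sum_ofFn_single] at h1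
  rw [← List.ofFn_eq_map, ← List.ofFn_eq_map, sum_ofFn_single (fun i => -wordDeg β i)] at h2
  rw [sub_eq_add_neg]
  exact h1.mul h2

/-! ### The universal model lies in the poly-hyperball -/

/-- `A` is the diagonal operator with entries `f`. -/
def IsDiag (f : MultiWord n → ℝ) (A : PolyFock n →L[ℂ] PolyFock n) : Prop :=
  ∀ α, A (basisVec α) = (f α : ℂ) • basisVec α

theorem IsDiag.apply {f : MultiWord n → ℝ} {A : PolyFock n →L[ℂ] PolyFock n} (hA : IsDiag f A)
    (x : PolyFock n) (β : MultiWord n) : A x β = (f β : ℂ) * x β := by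
  have h := ((hasSum_basisVec x).mapL A).mapL (innerSL ℂ (basisVec β))
  simp only [map_smul, hA _, innerSL_apply_apply, inner_basisVec_basisVec] at h
  rw [inner_basisVec] at h
  refine h.unique ?_
  convert hasSum_single β _ using 1
  · simp [mul_comm]
  · intro α hα
    simp [hα.symm]

/-- Here `⟪A x, x⟫` is the series of the nonnegative reals `f β * ‖x β‖ ^ 2`. -/
theorem IsDiag.isPositive {f : MultiWord n → ℝ} {A : PolyFock n →L[ℂ] PolyFock n}
    (hA : IsDiag f A) (hf : ∀ α, 0 ≤ f α) : A.IsPositive := by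
  rw [ContinuousLinearMap.isPositive_iff_complex]
  intro x
  have h : HasSum (fun β => ((f β * ‖x β‖ ^ 2 : ℝ) : ℂ)) (inner ℂ (A x) x) := by
    refine (lp.hasSum_inner (A x) x).congr_fun fun β => ?_
    rw [hA.apply, RCLike.inner_apply, map_mul, Complex.conj_ofReal]
    push_cast
    rw [← Complex.mul_conj']
    ring
  have hre := Complex.hasSum_re h
  have him := Complex.hasSum_im h
  simp only [Complex.ofReal_re, Complex.ofReal_im] at hre him
  have him0 := him.unique hasSum_zero
  constructor
  · apply Complex.ext
    · simp
    · simp [him0]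
  · exact hre.nonneg fun β => mul_nonneg (hf β) (sq_nonneg _)

theorem star_universalModel_basisVec_consWord (i : Fin k) (j j' : Fin (n i)) (γ : MultiWord n) :
    star (universalModel m i j) (basisVec (consWord i j' γ)) =
      if j = j' then (weight m i γ : ℂ) • basisVec γ else 0 := by
  ext β
  rw [star_universalModel_apply, basisVec_apply]
  by_cases hj : j = j'
  · subst hj
    rw [if_pos rfl, lp.coeFn_smul, Pi.smul_apply, basisVec_apply, smul_eq_mul]
    simp only [(consWord_injective i j).eq_iff]
    split_ifs with h <;> simp [h]
  · rw [if_neg hj, if_neg]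
    · simp
    · intro h
      have := congrFun h i
      simp only [consWord_same, List.cons.injEq] at this
      exact hj this.1

theorem star_universalModel_basisVec_of_nil (i : Fin k) (j : Fin (n i)) {α : MultiWord n}
    (h : α i = []) : star (universalModel m i j) (basisVec α) = 0 := by
  ext β
  rw [star_universalModel_apply, basisVec_apply, if_neg]
  · simp
  · intro h'
    have := congrFun h' i
    simp [consWord_same, h] at this

theorem phi_apply {H : Type*} [NormedAddCommGroup H] [InnerProductSpace ℂ H] [CompleteSpace H]
    (X : OpTuple n H) (i : Fin k) (Y : H →L[ℂ] H) (x : H) :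
    phi X i Y x = ∑ j, X i j (Y (star (X i j) x)) := by
  simp [phi, LinearMap.sum_apply]

theorem eq_consWord_of_cons {i : Fin k} {j : Fin (n i)} {l : List (Fin (n i))}
    {α : MultiWord n} (h : α i = j :: l) : α = consWord i j (Function.update α i l) := by
  funext t
  by_cases ht : t = i
  · subst ht
    simp [consWord, h]
  · simp [consWord, ht]

/-- Only the summand of `phi` whose letter matches the first letter of the word survives; the weight
enters once from `W^*` and once from `W`. -/
theorem phi_universalModel_consWord {f : MultiWord n → ℝ} {A : PolyFock n →L[ℂ] PolyFock n}
    (hA : IsDiag f A) (i : Fin k) (j : Fin (n i)) (γ : MultiWord n) :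
    phi (universalModel m) i A (basisVec (consWord i j γ)) =
      ((f γ * weight m i γ ^ 2 : ℝ) : ℂ) • basisVec (consWord i j γ) := by
  rw [phi_apply, Finset.sum_eq_single j]
  · rw [star_universalModel_basisVec_consWord, if_pos rfl]
    simp only [map_smul, hA γ, universalModel_basisVec, smul_smul]
    push_cast
    ring_nf
  · intro j' _ hj'
    rw [star_universalModel_basisVec_consWord, if_neg hj']
    simp
  · simp

theorem phi_universalModel_of_nil (A : PolyFock n →L[ℂ] PolyFock n) (i : Fin k)
    {α : MultiWord n} (h : α i = []) : phi (universalModel m) i A (basisVec α) = 0 := by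
  rw [phi_apply]
  simp [star_universalModel_basisVec_of_nil m i _ h]

/-- The `l`-th coefficient of `(1 - z) ^ p * (1 - z) ^ (-m)`, divided by that of
`(1 - z) ^ (-m)`. -/
def defectCoeff (m p l : ℕ) : ℝ := (m - p).multichoose l / m.multichoose l

theorem defectCoeff_nonneg (m p l : ℕ) : 0 ≤ defectCoeff m p l := by
  unfold defectCoeff
  positivity

theorem multichoose_pos {m : ℕ} (hm : 1 ≤ m) (l : ℕ) : 0 < m.multichoose l := by
  rw [Nat.multichoose_eq]
  exact Nat.choose_pos (by omega)

theorem defectCoeff_zero_left {m : ℕ} (hm : 1 ≤ m) (l : ℕ) : defectCoeff m 0 l = 1 := by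
  have := multichoose_pos hm l
  simp only [defectCoeff, Nat.sub_zero]
  exact div_self (by positivity)

theorem defectCoeff_zero_right (m p : ℕ) : defectCoeff m p 0 = 1 := by
  simp [defectCoeff]

/-- This explains the weights: `(l + 1) / (l + m)`, the squared weight at length `l`, is the ratio
of consecutive coefficients of `(1 - z) ^ (-m)`. -/
theorem multichoose_succ_mul {m : ℕ} (hm : 1 ≤ m) (l : ℕ) :
    m.multichoose (l + 1) * (l + 1) = m.multichoose l * (l + m) := by
  obtain ⟨m, rfl⟩ := Nat.exists_eq_add_of_le' hm
  rw [Nat.multichoose_eq, Nat.multichoose_eq]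
  have h := Nat.add_one_mul_choose_eq (m + l) l
  have h2 := Nat.choose_succ_right_eq (m + l + 1) l
  have e1 : m + 1 + (l + 1) - 1 = m + l + 1 := by omega
  have e2 : m + 1 + l - 1 = m + l := by omega
  rw [e1, e2, ← h]
  ring

/-- The squared weight turns the denominator of the second term into `m.multichoose (l + 1)`. What
remains is Pascal's rule for `multichoose`, the coefficient form of multiplying `(1 - z) ^ (-(m -
p))` by `1 - z`. -/
theorem defectCoeff_succ {m p : ℕ} (hm : 1 ≤ m) (hp : p < m) (l : ℕ) :
    defectCoeff m p (l + 1) - defectCoeff m p l * ((l + 1) / (l + m)) =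
      defectCoeff m (p + 1) (l + 1) := by
  have h0 := multichoose_pos hm l
  have h1 := multichoose_pos hm (l + 1)
  have hs : (m.multichoose (l + 1) : ℝ) * (l + 1) = m.multichoose l * (l + m) := by
    exact_mod_cast multichoose_succ_mul hm l
  have hq : m - p = (m - (p + 1)) + 1 := by omega
  have hc : ((m - p).multichoose (l + 1) : ℝ) =
      (m - (p + 1)).multichoose (l + 1) + (m - p).multichoose l := by
    rw [hq]
    exact_mod_cast Nat.multichoose_succ_succ _ _
  have h2 : (0 : ℝ) < l + m := by positivity
  have h0' : (0 : ℝ) < m.multichoose l := by exact_mod_cast h0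
  have h1' : (0 : ℝ) < m.multichoose (l + 1) := by exact_mod_cast h1
  unfold defectCoeff
  have : ((m - p).multichoose l : ℝ) / m.multichoose l * ((l + 1) / (l + m)) =
      (m - p).multichoose l / m.multichoose (l + 1) := by
    field_simp
    linear_combination ((m - p).multichoose l : ℝ) * hs
  rw [this, ← sub_div, hc]
  ring

theorem weight_sq (i : Fin k) (γ : MultiWord n) :
    weight m i γ ^ 2 = ((γ i).length + 1) / ((γ i).length + m i) := by
  rw [weight, Real.sq_sqrt (by positivity)]

/-- The diagonal entries of the defect operators of the universal model. -/
def defectEntry (p : Fin k → ℕ) (α : MultiWord n) : ℝ :=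
  ∏ i, defectCoeff (m i) (p i) (α i).length

theorem defectEntry_eq (p : Fin k → ℕ) (α : MultiWord n) (i : Fin k) :
    defectEntry m p α = defectCoeff (m i) (p i) (α i).length *
      ∏ l ∈ Finset.univ.erase i, defectCoeff (m l) (p l) (α l).length :=
  (Finset.mul_prod_erase _ _ (Finset.mem_univ i)).symm

variable {m}

/-- Deleting the first letter of the `i`-th word affects only the `i`-th factor of the diagonal
entry, so the claim reduces to the one-variable recursion `defectCoeff_succ`; for an empty word
`phi` contributes nothing. -/
theorem IsDiag.one_sub_phi (hm : ∀ i, 1 ≤ m i) {p : Fin k → ℕ} {i : Fin k} (hp : p i < m i)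
    {A : PolyFock n →L[ℂ] PolyFock n} (hA : IsDiag (defectEntry m p) A) :
    IsDiag (defectEntry m (p + Pi.single i 1)) ((1 - phi (universalModel m) i) A) := by
  intro α
  have hrest : ∀ β : MultiWord n, (∀ l, l ≠ i → β l = α l) →
      ∏ l ∈ Finset.univ.erase i, defectCoeff (m l) (p l) (β l).length =
      ∏ l ∈ Finset.univ.erase i,
        defectCoeff (m l) ((p + Pi.single i 1 : Fin k → ℕ) l) (α l).length := by
    intro β hβ
    refine Finset.prod_congr rfl fun l hl => ?_
    have hli := Finset.ne_of_mem_erase hl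
    simp [hβ l hli, hli]
  rw [LinearMap.sub_apply, sub_apply, Module.End.one_apply, hA α]
  rcases hα : α i with _ | ⟨j, l⟩
  · rw [phi_universalModel_of_nil m A i hα, sub_zero, defectEntry_eq m _ _ i,
      defectEntry_eq m _ _ i, hα, hrest α fun _ _ => rfl]
    simp [defectCoeff_zero_right]
  · set γ := Function.update α i l with hγ
    have hα' := eq_consWord_of_cons hα
    rw [← hγ] at hα'
    have hγi : γ i = l := by simp [hγ]
    rw [hα', phi_universalModel_consWord m hA, ← sub_smul, ← Complex.ofReal_sub, ← hα']
    congr 2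
    rw [weight_sq, hγi, defectEntry_eq m _ _ i, defectEntry_eq m _ γ i,
      defectEntry_eq m _ α i, hrest α fun _ _ => rfl, hrest γ fun t ht => by simp [hγ, ht], hα,
      hγi, Pi.add_apply, Pi.single_eq_same, List.length_cons, ← defectCoeff_succ (hm i) hp]
    ring

theorem IsDiag.one_sub_phi_pow (hm : ∀ i, 1 ≤ m i) {p : Fin k → ℕ} {i : Fin k} (q : ℕ)
    (hp : p i + q ≤ m i) {A : PolyFock n →L[ℂ] PolyFock n} (hA : IsDiag (defectEntry m p) A) :
    IsDiag (defectEntry m (p + Pi.single i q)) (((1 - phi (universalModel m) i) ^ q) A) := by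
  induction q with
  | zero => simpa using hA
  | succ q ih =>
    have h := (ih (by omega)).one_sub_phi hm (i := i) (by simp; omega)
    rw [pow_succ', Module.End.mul_apply, Pi.single_add, ← add_assoc]
    exact h

/-- The defect is an ordered product, so the factors are applied one at a time. Absence of
duplicates ensures that each exponent rises from `0` exactly once and stays within `m`. -/
theorem isDiag_list_defect (hm : ∀ i, 1 ≤ m i) {p : Fin k → ℕ} (hp : p ≤ m) (l : List (Fin k))
    (hl : l.Nodup) :
    IsDiag (n := n) (defectEntry m fun i => if i ∈ l then p i else 0)
      ((l.map fun i => (1 - phi (universalModel m) i) ^ p i).prod 1) := by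
  induction l with
  | nil =>
    intro α
    simp [defectEntry, defectCoeff_zero_left (hm _)]
  | cons a l ih =>
    rw [List.nodup_cons] at hl
    have h := (ih hl.2).one_sub_phi_pow hm (i := a) (p a) (by simpa [hl.1] using hp a)
    rw [List.map_cons, List.prod_cons, Module.End.mul_apply]
    convert h using 2
    funext i
    by_cases hi : i = a
    · subst hi
      simp [hl.1]
    · simp [hi]

theorem universalModel_mem_ball (hm : ∀ i, 1 ≤ m i) :
    (universalModel m : OpTuple n (PolyFock n)) ∈ ball n m (PolyFock n) := by
  constructor
  · intro p q hpq a b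
    refine ext_basisVec fun α => ?_
    have h1 : weight m p (consWord q b α) = weight m p α := by
      simp [weight, consWord_of_ne hpq]
    have h2 : weight m q (consWord p a α) = weight m q α := by
      simp [weight, consWord_of_ne hpq.symm]
    have h3 : consWord p a (consWord q b α) = consWord q b (consWord p a α) := by
      unfold consWord
      rw [Function.update_of_ne hpq, Function.update_of_ne hpq.symm, Function.update_comm hpq]
    simp only [mul_apply_eq_comp, universalModel_basisVec, map_smul, smul_smul, h1,
      h2, h3, mul_comm]
  · intro p hp
    have h := isDiag_list_defect (n := n) hm hp _ (List.nodup_finRange k)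
    rw [← List.ofFn_eq_map] at h
    exact h.isPositive fun α => Finset.prod_nonneg fun i _ => defectCoeff_nonneg _ _ _

end Fock

/-! ### Nested series -/

section Nested

theorem HasNestedSum.unique {E : Type*} [AddCommMonoid E] [TopologicalSpace E] [T2Space E]
    {k : ℕ} {f : (Fin k → ℤ) → E} {a b : E} (ha : HasNestedSum k f a)
    (hb : HasNestedSum k f b) : a = b := by
  induction k generalizing a b with
  | zero => exact Eq.trans (Eq.symm ha) hb
  | succ k ih =>
    obtain ⟨g, hg, hga⟩ := ha
    obtain ⟨g', hg', hgb⟩ := hb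
    obtain rfl : g = g' := funext fun s => ih (hg s) (hg' s)
    exact tendsto_nhds_unique hga hgb

theorem HasNestedSum.nestedSum_eq {E : Type*} [AddCommMonoid E] [TopologicalSpace E] [T2Space E]
    {k : ℕ} {f : (Fin k → ℤ) → E} {a : E} (ha : HasNestedSum k f a) : nestedSum f = a := by
  have h : ∃ a, HasNestedSum k f a := ⟨a, ha⟩
  rw [nestedSum, dif_pos h]
  exact h.choose_spec.unique ha

theorem HasNestedSum.map {E E' : Type*} [AddCommMonoid E] [TopologicalSpace E]
    [AddCommMonoid E'] [TopologicalSpace E'] {k : ℕ} {f : (Fin k → ℤ) → E} {a : E}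
    (ha : HasNestedSum k f a) (φ : E →+ E') (hφ : Continuous φ) :
    HasNestedSum k (fun s => φ (f s)) (φ a) := by
  induction k generalizing a with
  | zero => exact congrArg φ ha
  | succ k ih =>
    obtain ⟨g, hg, hga⟩ := ha
    refine ⟨fun s => φ (g s), fun s => ih (hg s), ?_⟩
    simpa only [← map_sum, Function.comp_def] using (hφ.tendsto a).comp hga

/-- Unconditional summability allows summing over fibres of the first coordinate, and the symmetric
intervals are cofinal among the finite subsets of `ℤ`. -/
theorem hasNestedSum_of_hasSum {E : Type*} [NormedAddCommGroup E] [CompleteSpace E]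
    {k : ℕ} {f : (Fin k → ℤ) → E} {a : E} (ha : HasSum f a) : HasNestedSum k f a := by
  induction k generalizing a with
  | zero =>
    refine Eq.trans ?_ ((hasSum_unique f).unique ha)
    exact congrArg f (Subsingleton.elim _ _)
  | succ k ih =>
    have h := (Fin.consEquiv fun _ : Fin (k + 1) => ℤ).hasSum_iff.mpr ha
    have hs : ∀ s : ℤ, Summable fun t : Fin k → ℤ => f (Fin.cons s t) := fun s =>
      h.summable.prod_factor s
    refine ⟨_, fun s => ih (hs s).hasSum, ?_⟩
    exact (h.prod_fiberwise fun s => (hs s).hasSum).comp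
      (Finset.tendsto_Icc_neg_atTop_atTop.comp tendsto_natCast_atTop_atTop)

theorem HasNestedSum.eq_of_support {E : Type*} [NormedAddCommGroup E] [CompleteSpace E] {k : ℕ}
    {f : (Fin k → ℤ) → E} {a : E} (ha : HasNestedSum k f a) (s₀ : Fin k → ℤ)
    (h : ∀ s, s ≠ s₀ → f s = 0) : a = f s₀ :=
  ha.unique (hasNestedSum_of_hasSum (hasSum_single s₀ h))

end Nested

/-! ### Elementary tensors -/

section Tensor

variable {K H : Type*} [NormedAddCommGroup K] [InnerProductSpace ℂ K]
  [NormedAddCommGroup H] [InnerProductSpace ℂ H]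

theorem inner_htmul (x x' : K) (y y' : H) :
    inner ℂ (htmul x y) (htmul x' y') = inner ℂ x x' * inner ℂ y y' := by
  rw [htmul, htmul, UniformSpace.Completion.inner_coe, TensorProduct.inner_tmul]

theorem norm_htmul (x : K) (y : H) : ‖htmul x y‖ = ‖x‖ * ‖y‖ := by
  rw [htmul, UniformSpace.Completion.norm_coe, TensorProduct.norm_tmul]

theorem opTensor_htmul (A : K →L[ℂ] K) (B : H →L[ℂ] H) (x : K) (y : H) :
    opTensor A B (htmul x y) = htmul (A x) (B y) := by
  rw [opTensor, htmul, ContinuousLinearMap.completion_apply_coe, TensorProduct.mapL_tmul]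
  rfl

/-- The map `y ↦ x ⊗ y`. -/
def htmulRight (x : K) : H →L[ℂ] HTensor K H :=
  LinearMap.mkContinuous
    { toFun := htmul x
      map_add' := fun y z => by
        simp only [htmul, TensorProduct.tmul_add, UniformSpace.Completion.coe_add]
      map_smul' := fun c y => by
        simp only [htmul, TensorProduct.tmul_smul, UniformSpace.Completion.coe_smul,
          RingHom.id_apply] }
    ‖x‖ fun y => (norm_htmul x y).le

theorem htmulRight_apply (x : K) (y : H) : htmulRight x y = htmul x y := rfl

theorem htmul_add_left (x x' : K) (y : H) : htmul (x + x') y = htmul x y + htmul x' y := by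
  simp only [htmul, TensorProduct.add_tmul, UniformSpace.Completion.coe_add]

theorem htmul_smul_left (c : ℂ) (x : K) (y : H) : htmul (c • x) y = c • htmul x y := by
  simp only [htmul, ← TensorProduct.smul_tmul', UniformSpace.Completion.coe_smul]

theorem htmul_zero_left (y : H) : htmul (0 : K) y = 0 := by
  simp [htmul]

end Tensor

/-! ### Polynomial vectors -/

section Poly

variable {k : ℕ} {n : Fin k → ℕ} {K : Type*} [NormedAddCommGroup K] [InnerProductSpace ℂ K]

theorem htmul_basisVec_mem (h : K) (α : MultiWord n) :
    htmul h (basisVec α) ∈ polyVectors n K :=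
  Submodule.subset_span ⟨h, α, rfl⟩

theorem dense_polyVectors : Dense (polyVectors n K : Set (HTensor K (PolyFock n))) := by
  have h1 : ∀ (h : K) (x : PolyFock n),
      htmul h x ∈ (polyVectors n K).topologicalClosure := by
    intro h x
    have hs := (hasSum_basisVec x).mapL (htmulRight h)
    refine (polyVectors n K).isClosed_topologicalClosure.mem_of_tendsto hs
      (Eventually.of_forall fun S => Submodule.sum_mem _ fun α _ => ?_)
    rw [map_smul]
    exact Submodule.smul_mem _ _
      ((polyVectors n K).le_topologicalClosure (htmul_basisVec_mem h α))
  rw [Submodule.dense_iff_topologicalClosure_eq_top, Submodule.eq_top_iff']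
  intro z
  induction z using UniformSpace.Completion.induction_on with
  | hp => exact (polyVectors n K).isClosed_topologicalClosure
  | ih z =>
    induction z with
    | zero => exact Submodule.zero_mem _
    | add x y hx hy =>
      rw [UniformSpace.Completion.coe_add]
      exact Submodule.add_mem _ hx hy
    | tmul x y => exact h1 x y

theorem inner_htmul_basisVec (h h' : K) (α β : MultiWord n) :
    inner ℂ (htmul h (basisVec α)) (htmul h' (basisVec β)) =
      if α = β then inner ℂ h h' else 0 := by
  rw [inner_htmul, inner_basisVec_basisVec]
  simp

/-- Two vectors with the same inner products with all `h ⊗ e_β` agree. -/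
theorem ext_inner_htmul_basisVec {x y : HTensor K (PolyFock n)}
    (h : ∀ (h' : K) (β : MultiWord n),
      inner ℂ (htmul h' (basisVec β)) x = inner ℂ (htmul h' (basisVec β)) y) : x = y := by
  refine dense_polyVectors.eq_of_inner_right ℂ fun v hv => ?_
  induction hv using Submodule.span_induction with
  | mem v hv =>
    obtain ⟨h', β, rfl⟩ := hv
    exact h h' β
  | zero => simp
  | add v w _ _ hv hw => rw [inner_add_left, inner_add_left, hv, hw]
  | smul c v _ hv => rw [inner_smul_left, inner_smul_left, hv]

/-- The vector `∑ h_α ⊗ e_α`. -/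
def polyVec (S : Finset (MultiWord n)) (h : MultiWord n → K) : HTensor K (PolyFock n) :=
  ∑ α ∈ S, htmul (h α) (basisVec α)

/-- The index set may be enlarged freely, so that two polynomial vectors can be written over a
common one. -/
theorem exists_polyVec {p : HTensor K (PolyFock n)} (hp : p ∈ polyVectors n K) :
    ∃ f : MultiWord n →₀ K, ∀ S, f.support ⊆ S → p = polyVec S f := by
  suffices ∃ f : MultiWord n →₀ K, p = f.sum fun α h => htmul h (basisVec α) by
    obtain ⟨f, rfl⟩ := this
    exact ⟨f, fun S hS => f.sum_of_support_subset hS _ fun α _ => htmul_zero_left _⟩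
  induction hp using Submodule.span_induction with
  | mem v hv =>
    obtain ⟨h, α, rfl⟩ := hv
    refine ⟨Finsupp.single α h, ?_⟩
    rw [Finsupp.sum_single_index (htmul_zero_left _)]
  | zero => exact ⟨0, Finsupp.sum_zero_index.symm⟩
  | add v w _ _ hv hw =>
    obtain ⟨f, rfl⟩ := hv
    obtain ⟨g, rfl⟩ := hw
    exact ⟨f + g, (Finsupp.sum_add_index' (fun _ => htmul_zero_left _)
      fun _ _ _ => htmul_add_left _ _ _).symm⟩
  | smul c v _ hv =>
    obtain ⟨f, rfl⟩ := hv
    refine ⟨c • f, ?_⟩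
    rw [Finsupp.sum_smul_index' fun _ => htmul_zero_left _, Finsupp.smul_sum]
    simp only [htmul_smul_left]

theorem norm_sq_polyVec (S : Finset (MultiWord n)) (h : MultiWord n → K) :
    ‖polyVec S h‖ ^ 2 = ∑ α ∈ S, ‖h α‖ ^ 2 := by
  rw [← Complex.ofReal_inj]
  push_cast
  have := inner_self_eq_norm_sq_to_K (𝕜 := ℂ) (polyVec S h)
  simp only [Complex.coe_algebraMap] at this
  rw [← this]
  simp only [polyVec, sum_inner, inner_sum, inner_htmul_basisVec]
  refine Finset.sum_congr rfl fun α hα => ?_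
  rw [Finset.sum_ite_eq', if_pos hα, inner_self_eq_norm_sq_to_K]
  rfl

end Poly

/-! ### The Schur multiplier `t ^ |a - b|` -/

section Schur

/-- The rows of a Cholesky factor of the kernel `t ^ |a - b|`. -/
def cholesky (t : ℝ) : ℕ → ℕ → ℝ
  | 0, c => if c = 0 then 1 else 0
  | a + 1, c => t * cholesky t a c + if c = a + 1 then Real.sqrt (1 - t ^ 2) else 0

theorem cholesky_eq_zero (t : ℝ) {a c : ℕ} (h : a < c) : cholesky t a c = 0 := by
  induction a with
  | zero => simp [cholesky, h.ne']
  | succ a ih => simp [cholesky, h.ne', ih (by omega)]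

/-- Each new row is `t` times the previous one plus an orthogonal vector of squared length `1 - t ^
2`, so the rows remain unit vectors. -/
theorem sum_cholesky_self {t : ℝ} (ht : t ∈ Set.Icc (0 : ℝ) 1) {N a : ℕ} (ha : a < N) :
    ∑ c ∈ Finset.range N, cholesky t a c * cholesky t a c = 1 := by
  induction a with
  | zero => simp [cholesky, ha]
  | succ a ih =>
    have hsq : Real.sqrt (1 - t ^ 2) ^ 2 = 1 - t ^ 2 :=
      Real.sq_sqrt (by nlinarith [ht.1, ht.2])
    have : ∀ c, cholesky t (a + 1) c * cholesky t (a + 1) c =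
        t ^ 2 * (cholesky t a c * cholesky t a c) + if c = a + 1 then 1 - t ^ 2 else 0 := by
      intro c
      by_cases hc : c = a + 1
      · subst hc
        rw [cholesky, cholesky_eq_zero t (Nat.lt_succ_self a)]
        simp only [if_true]
        linear_combination hsq
      · simp only [cholesky, hc, if_false]
        ring
    simp only [this, Finset.sum_add_distrib, ← Finset.mul_sum, ih (by omega)]
    simp [ha]

/-- Row `a` is supported on `c ≤ a`, hence is orthogonal to every coordinate added later; each
further row only multiplies the inner product by `t`. For the same reason `N` need only exceed `a`.
-/
theorem sum_cholesky_add {t : ℝ} (ht : t ∈ Set.Icc (0 : ℝ) 1) {N a : ℕ} (b : ℕ) (ha : a < N) :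
    ∑ c ∈ Finset.range N, cholesky t a c * cholesky t (a + b) c = t ^ b := by
  induction b with
  | zero => simpa using sum_cholesky_self ht ha
  | succ b ih =>
    rw [pow_succ', ← ih, Finset.mul_sum]
    refine Finset.sum_congr rfl fun c _ => ?_
    rw [← add_assoc, cholesky]
    by_cases hc : c = a + b + 1
    · rw [cholesky_eq_zero t (by omega : a < c)]
      ring
    · rw [if_neg hc]
      ring

theorem sum_cholesky {t : ℝ} (ht : t ∈ Set.Icc (0 : ℝ) 1) {N a b : ℕ} (ha : a < N)
    (hb : b < N) :
    ∑ c ∈ Finset.range N, cholesky t a c * cholesky t b c = t ^ ((b : ℤ) - a).natAbs := by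
  rcases le_total a b with h | h
  · obtain ⟨d, rfl⟩ := Nat.exists_eq_add_of_le h
    rw [sum_cholesky_add ht d ha]
    congr 1
    omega
  · obtain ⟨d, rfl⟩ := Nat.exists_eq_add_of_le h
    simp only [mul_comm (cholesky t (b + d) _)]
    rw [sum_cholesky_add ht d hb]
    congr 1
    omega

variable {k : ℕ} {n : Fin k → ℕ} {K : Type*} [NormedAddCommGroup K] [InnerProductSpace ℂ K]

/-- The total degree `∑ |s_i|`. -/
def totalDeg (s : Fin k → ℤ) : ℕ := ∑ i, (s i).natAbs

/-- The product of Cholesky factors over the tensor positions. -/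
def polyCholesky (t : ℝ) (α : MultiWord n) (c : Fin k → ℕ) : ℝ :=
  ∏ i, cholesky t (α i).length (c i)

theorem sum_polyCholesky {t : ℝ} (ht : t ∈ Set.Icc (0 : ℝ) 1) {N : ℕ} {α β : MultiWord n}
    (hα : ∀ i, (α i).length < N) (hβ : ∀ i, (β i).length < N) :
    ∑ c ∈ Fintype.piFinset fun _ : Fin k => Finset.range N,
      polyCholesky t α c * polyCholesky t β c = t ^ totalDeg (wordDeg β - wordDeg α) := by
  simp only [polyCholesky, ← Finset.prod_mul_distrib]
  rw [← Finset.prod_univ_sum (fun _ => Finset.range N)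
    (fun i c => cholesky t (α i).length c * cholesky t (β i).length c), totalDeg,
    ← Finset.prod_pow_eq_pow_sum]
  exact Finset.prod_congr rfl fun i _ => sum_cholesky ht (hα i) (hβ i)

/-- If the matrix of `Y` is the entrywise product of that of `Z` with `t ^ ∑ ||β_i| - |α_i||`, then
`‖Y‖ ≤ ‖Z‖`. -/
theorem norm_le_of_schur {t : ℝ} (ht : t ∈ Set.Icc (0 : ℝ) 1)
    {Y Z : HTensor K (PolyFock n) →L[ℂ] HTensor K (PolyFock n)}
    (hYZ : ∀ (h h' : K) (α β : MultiWord n),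
      inner ℂ (htmul h' (basisVec β)) (Y (htmul h (basisVec α))) =
        (t ^ totalDeg (wordDeg β - wordDeg α) : ℝ) *
          inner ℂ (htmul h' (basisVec β)) (Z (htmul h (basisVec α)))) : ‖Y‖ ≤ ‖Z‖ := by
  -- Factoring the kernel splits the form of `Y` as `∑ c, ⟪Q c, Z (P c)⟫`, where the `P c` and `Q c`
  -- have total squared norm `‖p‖ ^ 2` and `‖q‖ ^ 2`; Cauchy–Schwarz over `c` finishes.
  have key : ∀ p ∈ polyVectors n K, ∀ q ∈ polyVectors n K,
      ‖inner ℂ q (Y p)‖ ≤ ‖Z‖ * ‖p‖ * ‖q‖ := by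
    intro p hp q hq
    obtain ⟨f, hf⟩ := exists_polyVec hp
    obtain ⟨g, hg⟩ := exists_polyVec hq
    set S := f.support ∪ g.support
    have hp' := hf S Finset.subset_union_left
    have hq' := hg S Finset.subset_union_right
    -- `N` exceeds every word length that occurs, so sums over `c` below `N` contain the full
    -- Cholesky rows.
    set N := (S.sup fun α => Finset.univ.sup fun i => (α i).length) + 1
    have hN : ∀ α ∈ S, ∀ i, (α i).length < N := by
      intro α hα i
      have h1 : (α i).length ≤ Finset.univ.sup fun i => (α i).length :=
        Finset.le_sup (f := fun i => (α i).length) (Finset.mem_univ i)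
      have h2 := Finset.le_sup (f := fun α : MultiWord n =>
        Finset.univ.sup fun i => (α i).length) hα
      exact Nat.lt_succ_of_le (h1.trans h2)
    set C := Fintype.piFinset fun _ : Fin k => Finset.range N
    let P : (Fin k → ℕ) → HTensor K (PolyFock n) := fun c =>
      polyVec S fun α => (polyCholesky t α c : ℂ) • f α
    let Q : (Fin k → ℕ) → HTensor K (PolyFock n) := fun c =>
      polyVec S fun α => (polyCholesky t α c : ℂ) • g α
    have hnorm : ∀ u : MultiWord n → K,
        ∑ c ∈ C, ‖polyVec S fun α => (polyCholesky t α c : ℂ) • u α‖ ^ 2 =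
          ‖polyVec S u‖ ^ 2 := by
      intro u
      simp only [norm_sq_polyVec]
      rw [Finset.sum_comm]
      refine Finset.sum_congr rfl fun α hα => ?_
      simp only [norm_smul, mul_pow, Complex.norm_real, Real.norm_eq_abs, sq_abs]
      rw [← Finset.sum_mul]
      simp only [sq (polyCholesky t α _)]
      -- The kernel equals `1` on the diagonal, so the squared norm is preserved.
      rw [sum_polyCholesky ht (hN α hα) (hN α hα)]
      simp [totalDeg]
    have hsum : inner ℂ q (Y p) = ∑ c ∈ C, inner ℂ (Q c) (Z (P c)) := by
      have h1 : inner ℂ q (Y p) = ∑ β ∈ S, ∑ α ∈ S, ∑ c ∈ C,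
          ((polyCholesky t α c * polyCholesky t β c : ℝ) : ℂ) *
            inner ℂ (htmul (g β) (basisVec β)) (Z (htmul (f α) (basisVec α))) := by
        rw [hp', hq']
        simp only [polyVec, map_sum, sum_inner, inner_sum]
        rw [Finset.sum_comm]
        refine Finset.sum_congr rfl fun β hβ => Finset.sum_congr rfl fun α hα => ?_
        rw [hYZ, ← Finset.sum_mul, ← sum_polyCholesky ht (hN α hα) (hN β hβ)]
        push_cast
        rfl
      have h2 : ∀ c, inner ℂ (Q c) (Z (P c)) = ∑ β ∈ S, ∑ α ∈ S,
          ((polyCholesky t α c * polyCholesky t β c : ℝ) : ℂ) *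
            inner ℂ (htmul (g β) (basisVec β)) (Z (htmul (f α) (basisVec α))) := by
        intro c
        simp only [P, Q, polyVec, map_sum, sum_inner, inner_sum, htmul_smul_left, map_smul,
          inner_smul_left, inner_smul_right, Complex.conj_ofReal]
        simp only [Finset.mul_sum]
        rw [Finset.sum_comm]
        refine Finset.sum_congr rfl fun β hβ => Finset.sum_congr rfl fun α hα => ?_
        push_cast
        ring
      simp only [h1, h2]
      rw [Finset.sum_comm (s := C)]
      refine Finset.sum_congr rfl fun β _ => ?_
      rw [Finset.sum_comm]
    calc ‖inner ℂ q (Y p)‖ ≤ ∑ c ∈ C, ‖inner ℂ (Q c) (Z (P c))‖ := by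
          rw [hsum]
          exact norm_sum_le _ _
      _ ≤ ∑ c ∈ C, ‖Z‖ * (‖P c‖ * ‖Q c‖) := by
          refine Finset.sum_le_sum fun c _ => ?_
          calc ‖inner ℂ (Q c) (Z (P c))‖ ≤ ‖Q c‖ * ‖Z (P c)‖ := norm_inner_le_norm _ _
            _ ≤ ‖Q c‖ * (‖Z‖ * ‖P c‖) := by gcongr; exact Z.le_opNorm _
            _ = _ := by ring
      _ ≤ ‖Z‖ * (‖p‖ * ‖q‖) := by
          rw [← Finset.mul_sum]
          gcongr
          refine (Real.sum_mul_le_sqrt_mul_sqrt _ _ _).trans ?_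
          rw [hnorm, hnorm, ← hp', ← hq', Real.sqrt_sq (norm_nonneg _),
            Real.sqrt_sq (norm_nonneg _)]
      _ = _ := by ring
  have key' : ∀ p q, ‖inner ℂ q (Y p)‖ ≤ ‖Z‖ * ‖p‖ * ‖q‖ := by
    have h1 : ∀ p ∈ polyVectors n K, ∀ q, ‖inner ℂ q (Y p)‖ ≤ ‖Z‖ * ‖p‖ * ‖q‖ := by
      intro p hp q
      refine dense_polyVectors.induction (P := fun q => ‖inner ℂ q (Y p)‖ ≤ ‖Z‖ * ‖p‖ * ‖q‖)
        (key p hp) (isClosed_le (by fun_prop) (by fun_prop)) q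
    intro p q
    exact dense_polyVectors.induction (P := fun p => ‖inner ℂ q (Y p)‖ ≤ ‖Z‖ * ‖p‖ * ‖q‖)
      (fun p hp => h1 p hp q) (isClosed_le (by fun_prop) (by fun_prop)) p
  refine ContinuousLinearMap.opNorm_le_bound _ Z.opNorm_nonneg fun p => ?_
  -- Testing against `q = Y p` and cancelling one factor `‖Y p‖` gives the operator bound.
  have h := key' p (Y p)
  rw [inner_self_eq_norm_sq_to_K] at h
  rcases (norm_nonneg (Y p)).eq_or_lt with h0 | h0
  · rw [← h0]
    positivity
  · refine le_of_mul_le_mul_right ?_ h0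
    simpa [sq] using h

end Schur

/-! ### Homogeneous parts at the universal model -/

section HomPart

variable {k : ℕ} {n : Fin k → ℕ}

theorem wordOp_scale {H : Type*} [NormedAddCommGroup H] [InnerProductSpace ℂ H] (r : ℝ)
    (X : OpTuple n H) (i : Fin k) (α : List (Fin (n i))) :
    wordOp (scale r X) i α = ((r : ℂ) ^ α.length) • wordOp X i α := by
  induction α with
  | nil => simp [wordOp]
  | cons a l ih =>
    simp only [wordOp, List.map_cons, List.prod_cons, List.length_cons] at ih ⊢
    rw [ih, scale, smul_mul_smul_comm, pow_succ']

theorem list_prod_smul {ι R : Type*} [Ring R] [Algebra ℂ R] (l : List ι) (c : ι → ℂ)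
    (A : ι → R) : (l.map fun i => c i • A i).prod = (l.map c).prod • (l.map A).prod := by
  induction l with
  | nil => simp
  | cons a l ih => simp only [List.map_cons, List.prod_cons, ih, smul_mul_smul_comm]

theorem monomial_scale {H : Type*} [NormedAddCommGroup H] [InnerProductSpace ℂ H]
    [CompleteSpace H] (r : ℝ) (X : OpTuple n H) (α β : MultiWord n) :
    monomial (scale r X) α β =
      ((r : ℂ) ^ (∑ i, (α i).length + ∑ i, (β i).length)) • monomial X α β := by
  have hstar : ∀ i, star (wordOp (scale r X) i (β i)) =
      ((r : ℂ) ^ (β i).length) • star (wordOp X i (β i)) := by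
    intro i
    rw [wordOp_scale, star_smul]
    simp
  simp only [monomial, hstar, List.ofFn_eq_map]
  simp only [wordOp_scale]
  rw [list_prod_smul, list_prod_smul, smul_mul_smul_comm, ← List.ofFn_eq_map,
    ← List.ofFn_eq_map, List.prod_ofFn, List.prod_ofFn, Finset.prod_pow_eq_pow_sum,
    Finset.prod_pow_eq_pow_sum, pow_add]

variable {K : Type*} [NormedAddCommGroup K] [InnerProductSpace ℂ K]

theorem homPart_htmul {H : Type*} [NormedAddCommGroup H] [InnerProductSpace ℂ H]
    [CompleteSpace H] (F : Coeffs n K) (X : OpTuple n H) (s : Fin k → ℤ) (x : K) (y : H) :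
    homPart F X s (htmul x y) =
      ∑ a : (∀ i, Fin (s i).toNat → Fin (n i)), ∑ b : (∀ i, Fin (-s i).toNat → Fin (n i)),
        htmul (F (fun i => List.ofFn (a i)) (fun i => List.ofFn (b i)) x)
          (monomial X (fun i => List.ofFn (a i)) (fun i => List.ofFn (b i)) y) := by
  simp only [homPart, sum_apply, opTensor_htmul]

/-- Every monomial of `q_s` has `∑ (s_i^+ + s_i^-) = ∑ |s_i|` factors. -/
theorem homPart_scale_htmul {H : Type*} [NormedAddCommGroup H] [InnerProductSpace ℂ H]
    [CompleteSpace H] (F : Coeffs n K) (r : ℝ) (X : OpTuple n H) (s : Fin k → ℤ) (x : K) (y : H) :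
    homPart F (scale r X) s (htmul x y) =
      ((r ^ totalDeg s : ℝ) : ℂ) • homPart F X s (htmul x y) := by
  simp only [homPart_htmul, Finset.smul_sum]
  refine Finset.sum_congr rfl fun a _ => Finset.sum_congr rfl fun b _ => ?_
  rw [monomial_scale, smul_apply, ← htmulRight_apply, map_smul, htmulRight_apply,
    Complex.ofReal_pow]
  congr 2
  simp only [List.length_ofFn, totalDeg, ← Finset.sum_add_distrib]
  exact Finset.sum_congr rfl fun i _ => by omega

/-- The span of the vectors `h ⊗ x` with `x` homogeneous of degree `d`. -/
def homSpace (n : Fin k → ℕ) (K : Type*) [NormedAddCommGroup K] [InnerProductSpace ℂ K]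
    (d : Fin k → ℤ) : Submodule ℂ (HTensor K (PolyFock n)) :=
  Submodule.span ℂ {v | ∃ (h : K) (x : PolyFock n), IsHomogeneous d x ∧ v = htmul h x}

theorem inner_homSpace {d e : Fin k → ℤ} (hde : d ≠ e) {v w : HTensor K (PolyFock n)}
    (hv : v ∈ homSpace n K d) (hw : w ∈ homSpace n K e) : inner ℂ v w = 0 := by
  have h : ∀ (h : K) (x : PolyFock n), IsHomogeneous d x → inner ℂ (htmul h x) w = 0 := by
    intro h x hx
    induction hw using Submodule.span_induction with
    | mem w hw =>
      obtain ⟨h', y, hy, rfl⟩ := hw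
      rw [inner_htmul, hx.inner_eq_zero hy hde, mul_zero]
    | zero => simp
    | add v w _ _ hv hw => rw [inner_add_right, hv, hw, add_zero]
    | smul c v _ hv => rw [inner_smul_right, hv, mul_zero]
  induction hv using Submodule.span_induction with
  | mem v hv =>
    obtain ⟨h', y, hy, rfl⟩ := hv
    exact h h' y hy
  | zero => simp
  | add v w _ _ hv hw => rw [inner_add_left, hv, hw, add_zero]
  | smul c v _ hv => rw [inner_smul_left, hv, mul_zero]

theorem htmul_basisVec_mem_homSpace (h : K) (β : MultiWord n) :
    htmul h (basisVec β) ∈ homSpace n K (wordDeg β) :=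
  Submodule.subset_span ⟨h, _, isHomogeneous_basisVec β, rfl⟩

/-- A vector orthogonal to all `h ⊗ e_β` with `β` of degree `d` is orthogonal to the space of
degree `d`. -/
theorem inner_homSpace_eq_zero {d : Fin k → ℤ} {z : HTensor K (PolyFock n)}
    (hz : ∀ (h : K) (β : MultiWord n), wordDeg β = d → inner ℂ (htmul h (basisVec β)) z = 0)
    {v : HTensor K (PolyFock n)} (hv : v ∈ homSpace n K d) : inner ℂ z v = 0 := by
  induction hv using Submodule.span_induction with
  | mem v hv =>
    obtain ⟨h, x, hx, rfl⟩ := hv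
    have hs := ((hasSum_basisVec x).mapL (htmulRight h)).mapL (innerSL ℂ z)
    refine hs.unique ?_
    convert hasSum_zero with β
    rw [map_smul, map_smul, innerSL_apply_apply, htmulRight_apply]
    by_cases hβ : wordDeg β = d
    · rw [inner_eq_zero_symm.mp (hz h β hβ), smul_zero]
    · rw [hx β hβ, zero_smul]
  | zero => simp
  | add v w _ _ hv hw => rw [inner_add_right, hv, hw, add_zero]
  | smul c v _ hv => rw [inner_smul_right, hv, mul_zero]

variable (m : Fin k → ℕ)

theorem homPart_mem_homSpace (F : Coeffs n K) (s : Fin k → ℤ) (h : K) (α : MultiWord n) :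
    homPart F (universalModel m) s (htmul h (basisVec α)) ∈ homSpace n K (wordDeg α + s) := by
  rw [homPart_htmul]
  refine Submodule.sum_mem _ fun a _ => Submodule.sum_mem _ fun b _ =>
    Submodule.subset_span ⟨_, _, ?_, rfl⟩
  have hs : (wordDeg (fun i => List.ofFn (a i)) - wordDeg (fun i => List.ofFn (b i)) :
      Fin k → ℤ) = s := by
    funext i
    simp only [wordDeg, Pi.sub_apply, List.length_ofFn]
    omega
  have := shiftsDeg_monomial m (fun i => List.ofFn (a i)) (fun i => List.ofFn (b i))
  rw [hs] at this
  exact this _ _ (isHomogeneous_basisVec α)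

theorem inner_homPart_eq_zero (F : Coeffs n K) {s : Fin k → ℤ} (h h' : K) {α β : MultiWord n}
    (hs : s ≠ wordDeg β - wordDeg α) :
    inner ℂ (htmul h' (basisVec β)) (homPart F (universalModel m) s (htmul h (basisVec α))) =
      0 := by
  refine inner_homSpace (fun h => hs ?_) (htmul_basisVec_mem_homSpace h' β)
    (homPart_mem_homSpace m F s h α)
  rw [h, add_sub_cancel_left]

/-- The matrix entry of `F(W)` at `h ⊗ e_α`, `h' ⊗ e_β`. -/
def modelEntry (F : Coeffs n K) (h h' : K) (α β : MultiWord n) : ℂ :=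
  inner ℂ (htmul h' (basisVec β))
    (homPart F (universalModel m) (wordDeg β - wordDeg α) (htmul h (basisVec α)))

variable {m}

/-- A matrix entry is a continuous linear functional of the operator, so it passes through the
nested series, and the grading kills every term but one. -/
theorem inner_of_hasNestedSum {F : Coeffs n K} {r : ℝ}
    {Y : HTensor K (PolyFock n) →L[ℂ] HTensor K (PolyFock n)}
    (hY : HasNestedSum k (fun s => homPart F (scale r (universalModel m)) s) Y)
    (h h' : K) (α β : MultiWord n) :
    inner ℂ (htmul h' (basisVec β)) (Y (htmul h (basisVec α))) =
      (r ^ totalDeg (wordDeg β - wordDeg α) : ℝ) * modelEntry m F h h' α β := by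
  let φ : (HTensor K (PolyFock n) →L[ℂ] HTensor K (PolyFock n)) →L[ℂ] ℂ :=
    (innerSL ℂ (htmul h' (basisVec β))).comp
      (ContinuousLinearMap.apply ℂ _ (htmul h (basisVec α)))
  have hφ : ∀ A, φ A = inner ℂ (htmul h' (basisVec β)) (A (htmul h (basisVec α))) :=
    fun A => rfl
  have hφs : ∀ s, φ (homPart F (scale r (universalModel m)) s) = (r ^ totalDeg s : ℝ) *
      inner ℂ (htmul h' (basisVec β))
        (homPart F (universalModel m) s (htmul h (basisVec α))) := by
    intro s
    rw [hφ, homPart_scale_htmul, inner_smul_right]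
  have := (hY.map (AddMonoidHomClass.toAddMonoidHom φ) φ.continuous).eq_of_support
    (wordDeg β - wordDeg α) fun s hs => by
      refine (hφs s).trans ?_
      rw [inner_homPart_eq_zero m F h h' hs, mul_zero]
  exact this.trans (hφs _)

/-- If `T` has the matrix of `F(W)`, then `∑ q_s(W, W^*) p` converges to `T p` for polynomial
vectors `p`. -/
theorem hasSum_homPart {F : Coeffs n K}
    {T : HTensor K (PolyFock n) →L[ℂ] HTensor K (PolyFock n)}
    (hT : ∀ (h h' : K) (α β : MultiWord n),
      inner ℂ (htmul h' (basisVec β)) (T (htmul h (basisVec α))) = modelEntry m F h h' α β)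
    {p : HTensor K (PolyFock n)} (hp : p ∈ polyVectors n K) :
    HasSum (fun s => homPart F (universalModel m) s p) (T p) := by
  induction hp using Submodule.span_induction with
  | mem v hv =>
    obtain ⟨h, α, rfl⟩ := hv
    set p := htmul h (basisVec α) with hp
    let v : ∀ s : Fin k → ℤ, homSpace n K (wordDeg α + s) := fun s =>
      ⟨_, homPart_mem_homSpace m F s h α⟩
    have hv : ∀ s, (v s : HTensor K (PolyFock n)) = homPart F (universalModel m) s p :=
      fun s => rfl
    have horth : OrthogonalFamily ℂ (fun s => homSpace n K (wordDeg α + s))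
        fun s => (homSpace n K (wordDeg α + s)).subtypeₗᵢ := by
      intro s t hst x y
      exact inner_homSpace (fun h => hst (add_left_cancel h)) x.2 y.2
    -- `v s` is the component of `T p` of degree `wordDeg α + s`: their difference is orthogonal to
    -- that homogeneous space.
    have hin : ∀ s, inner ℂ (T p) (v s : HTensor K (PolyFock n)) = (‖v s‖ ^ 2 : ℝ) := by
      intro s
      have h0 : inner ℂ (T p - v s) (v s : HTensor K (PolyFock n)) = 0 := by
        refine inner_homSpace_eq_zero (d := wordDeg α + s) (fun h' β hβ => ?_) (v s).2
        rw [inner_sub_right, hT, hv, modelEntry, hβ, add_sub_cancel_left, sub_self]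
      rw [inner_sub_left, sub_eq_zero] at h0
      rw [h0, inner_self_eq_norm_sq_to_K]
      push_cast
      rfl
    -- Bessel's inequality: pairing `T p` with a finite sum `x` of components gives `‖x‖ ^ 2 ≤ ‖T p‖
    -- * ‖x‖`.
    have hsum : Summable fun s => ‖v s‖ ^ 2 := by
      refine summable_of_sum_le (c := ‖T p‖ ^ 2) (fun s => sq_nonneg _) fun S => ?_
      have h1 : ‖∑ s ∈ S, (v s : HTensor K (PolyFock n))‖ ^ 2 = ∑ s ∈ S, ‖v s‖ ^ 2 :=
        horth.norm_sum v S
      have h2 : inner ℂ (T p) (∑ s ∈ S, (v s : HTensor K (PolyFock n))) =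
          ((∑ s ∈ S, ‖v s‖ ^ 2 : ℝ) : ℂ) := by
        rw [inner_sum, Complex.ofReal_sum]
        exact Finset.sum_congr rfl fun s _ => hin s
      have h3 := norm_inner_le_norm (𝕜 := ℂ) (T p) (∑ s ∈ S, (v s : HTensor K (PolyFock n)))
      rw [h2, Complex.norm_real, Real.norm_of_nonneg (by positivity), ← h1] at h3
      rw [← h1]
      nlinarith [norm_nonneg (T p), norm_nonneg (∑ s ∈ S, (v s : HTensor K (PolyFock n)))]
    have hsv : Summable fun s => homPart F (universalModel m) s p :=
      (horth.summable_iff_norm_sq_summable v).mpr hsum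
    convert hsv.hasSum
    refine ext_inner_htmul_basisVec fun h' β => ?_
    have := hsv.hasSum.mapL (innerSL ℂ (htmul h' (basisVec β)))
    rw [hT]
    refine ((hasSum_single (wordDeg β - wordDeg α) fun s hs => ?_).unique this)
    exact inner_homPart_eq_zero m F h h' hs
  | zero => simp
  | add v w _ _ hv hw => simpa using hv.add hw
  | smul c v _ hv => simpa using hv.const_smul c

end HomPart

end PolyHyperball

end

/-! ### Comparison of the norms of `F(rW)`, `T` and `F(W)` -/

open PolyHyperball

theorem mainTheorem10 {K : Type*} [NormedAddCommGroup K] [InnerProductSpace ℂ K] [CompleteSpace K]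
    {k : ℕ} (n m : Fin k → ℕ) (hn : ∀ i, 1 ≤ n i) (hm : ∀ i, 1 ≤ m i)
    (T : PolyHyperball.HTensor K (PolyHyperball.PolyFock n) →L[ℂ]
      PolyHyperball.HTensor K (PolyHyperball.PolyFock n))
    (F : PolyHyperball.Coeffs n K)
    (hF : PolyHyperball.IsBoundedFreePluriharmonic.{_, 0} m F)
    (hT : ∀ x : PolyHyperball.HTensor K (PolyHyperball.PolyFock n),
      Tendsto (fun r : ℝ =>
          PolyHyperball.evalOp F (PolyHyperball.scale r (PolyHyperball.universalModel m)) x)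
        (𝓝[<] 1) (𝓝 (T x))) :
    (∀ r ∈ Set.Ico (0 : ℝ) 1,
      PolyHyperball.scale r (PolyHyperball.universalModel m) ∈
        PolyHyperball.radialBall n m (PolyHyperball.PolyFock n)) ∧
    IsLUB ((fun r : ℝ =>
        ‖PolyHyperball.evalOp F (PolyHyperball.scale r (PolyHyperball.universalModel m))‖) ''
          Set.Ico (0 : ℝ) 1) ‖T‖ ∧
    MonotoneOn (fun r : ℝ =>
        ‖PolyHyperball.evalOp F (PolyHyperball.scale r (PolyHyperball.universalModel m))‖)
      (Set.Ico (0 : ℝ) 1) ∧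
    Tendsto (fun r : ℝ =>
        ‖PolyHyperball.evalOp F (PolyHyperball.scale r (PolyHyperball.universalModel m))‖)
      (𝓝[<] 1) (𝓝 ‖T‖) ∧
    (∀ p ∈ PolyHyperball.polyVectors n K,
      ∃ y, PolyHyperball.HasNestedSum k
        (fun s => PolyHyperball.homPart F (PolyHyperball.universalModel m) s p) y) ∧
    IsLUB ((fun p => ‖PolyHyperball.evalVec F (PolyHyperball.universalModel m) p‖) ''
      {p | p ∈ PolyHyperball.polyVectors n K ∧ ‖p‖ ≤ 1}) ‖T‖ := by
  have hrad : ∀ r ∈ Set.Ico (0 : ℝ) 1,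
      scale r (universalModel m) ∈ radialBall n m (PolyFock n) := fun r hr =>
    ⟨r, hr, universalModel m, universalModel_mem_ball hm, rfl⟩
  set Y : ℝ → HTensor K (PolyFock n) →L[ℂ] HTensor K (PolyFock n) := fun r =>
    evalOp F (scale r (universalModel m)) with hYdef
  have hY : ∀ r ∈ Set.Ico (0 : ℝ) 1, ∀ (h h' : K) (α β : MultiWord n),
      inner ℂ (htmul h' (basisVec β)) (Y r (htmul h (basisVec α))) =
        (r ^ totalDeg (wordDeg β - wordDeg α) : ℝ) * modelEntry m F h h' α β := by
    intro r hr
    obtain ⟨Z, hZ⟩ := hF.1 _ _ (hrad r hr)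
    have : Y r = Z := hZ.nestedSum_eq
    rw [this]
    exact inner_of_hasNestedSum hZ
  have hev : ∀ᶠ r in 𝓝[<] (1 : ℝ), r ∈ Set.Ico (0 : ℝ) 1 := Ico_mem_nhdsLT one_pos
  -- Entries of `F(rW)` converge to those of `T` by hypothesis, and to those of `F(W)` because the
  -- factor `r ^ ∑ |s_i|` tends to `1`.
  have hTe : ∀ (h h' : K) (α β : MultiWord n),
      inner ℂ (htmul h' (basisVec β)) (T (htmul h (basisVec α))) =
        modelEntry m F h h' α β := by
    intro h h' α β
    have h1 : Tendsto (fun r => inner ℂ (htmul h' (basisVec β)) (Y r (htmul h (basisVec α))))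
        (𝓝[<] 1) (𝓝 (inner ℂ (htmul h' (basisVec β)) (T (htmul h (basisVec α))))) :=
      tendsto_const_nhds.inner (hT _)
    have h2 : Tendsto (fun r : ℝ => ((r ^ totalDeg (wordDeg β - wordDeg α) : ℝ) : ℂ) *
        modelEntry m F h h' α β) (𝓝[<] 1) (𝓝 (modelEntry m F h h' α β)) := by
      have : Continuous fun r : ℝ => ((r ^ totalDeg (wordDeg β - wordDeg α) : ℝ) : ℂ) *
        modelEntry m F h h' α β := by fun_prop
      simpa using (this.tendsto 1).mono_left nhdsWithin_le_nhds
    exact tendsto_nhds_unique h1 (h2.congr' (hev.mono fun r hr => (hY r hr h h' α β).symm))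
  have hle : ∀ r ∈ Set.Ico (0 : ℝ) 1, ‖Y r‖ ≤ ‖T‖ := fun r hr =>
    norm_le_of_schur ⟨hr.1, hr.2.le⟩ fun h h' α β => by rw [hY r hr, hTe]
  have hmono : MonotoneOn (fun r => ‖Y r‖) (Set.Ico 0 1) := by
    intro r hr s hs hrs
    -- The multiplier carrying `F(sW)` to `F(rW)` has parameter `r / s`; the case `s = 0` forces `r
    -- = s`.
    rcases hs.1.eq_or_lt with h0 | h0
    · have : r = s := le_antisymm hrs (h0 ▸ hr.1)
      rw [this]
    · refine norm_le_of_schur (t := r / s) ⟨div_nonneg hr.1 hs.1, div_le_one_of_le₀ hrs hs.1⟩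
        fun h h' α β => ?_
      rw [hY r hr, hY s hs, ← mul_assoc, ← Complex.ofReal_mul, ← mul_pow,
        div_mul_cancel₀ _ h0.ne']
  have hlub : IsLUB ((fun r => ‖Y r‖) '' Set.Ico (0 : ℝ) 1) ‖T‖ := by
    refine ⟨Set.forall_mem_image.mpr hle, fun b hb => ?_⟩
    have hb' : ∀ r ∈ Set.Ico (0 : ℝ) 1, ‖Y r‖ ≤ b := fun r hr =>
      hb (Set.mem_image_of_mem _ hr)
    have hb0 : 0 ≤ b := (Y 0).opNorm_nonneg.trans (hb' 0 ⟨le_rfl, one_pos⟩)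
    refine T.opNorm_le_bound hb0 fun x => ?_
    -- Lower semicontinuity of the operator norm under strong limits.
    exact le_of_tendsto (hT x).norm (hev.mono fun r hr => (Y r).le_of_opNorm_le (hb' r hr) x)
  have hsum : ∀ p ∈ polyVectors n K,
      HasNestedSum k (fun s => homPart F (universalModel m) s p) (T p) := fun p hp =>
    hasNestedSum_of_hasSum (hasSum_homPart hTe hp)
  refine ⟨hrad, hlub, hmono, ?_, fun p hp => ⟨_, hsum p hp⟩, ?_⟩
  · refine tendsto_order.mpr ⟨fun a ha => ?_, fun a ha => ?_⟩
    · obtain ⟨_, ⟨r, hr, rfl⟩, har, -⟩ := hlub.exists_between ha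
      filter_upwards [Ioo_mem_nhdsLT hr.2] with s hs
      exact har.trans_le (hmono hr ⟨hr.1.trans hs.1.le, hs.2⟩ hs.1.le)
    · filter_upwards [hev] with r hr
      exact (hle r hr).trans_lt ha
  · have hval : ∀ p ∈ polyVectors n K, evalVec F (universalModel m) p = T p := fun p hp =>
      (hsum p hp).nestedSum_eq
    constructor
    · rintro _ ⟨p, ⟨hp, hp1⟩, rfl⟩
      change ‖evalVec F (universalModel m) p‖ ≤ ‖T‖
      rw [hval p hp]
      exact T.unit_le_opNorm p hp1
    · intro b hb
      have hb' : ∀ p ∈ polyVectors n K, ‖p‖ ≤ 1 → ‖T p‖ ≤ b := fun p hp hp1 => by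
        rw [← hval p hp]
        exact hb ⟨p, ⟨hp, hp1⟩, rfl⟩
      have hb0 : 0 ≤ b := by simpa using hb' 0 (Submodule.zero_mem _) (by simp)
      refine T.opNorm_le_bound hb0 fun x => ?_
      refine dense_polyVectors.induction (P := fun x => ‖T x‖ ≤ b * ‖x‖) (fun p hp => ?_)
        (isClosed_le (by fun_prop) (by fun_prop)) x
      rcases eq_or_ne p 0 with rfl | h0
      · simp
      · have hp0 : 0 < ‖p‖ := norm_pos_iff.mpr h0
        have := hb' (((‖p‖⁻¹ : ℝ) : ℂ) • p) (Submodule.smul_mem _ _ hp) (by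
          rw [norm_smul, Complex.norm_real, norm_inv, norm_norm, inv_mul_cancel₀ hp0.ne'])
        rw [map_smul, norm_smul, Complex.norm_real, norm_inv, norm_norm] at this
        rwa [inv_mul_le_iff₀ hp0, mul_comm] at this
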